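/- An MV-algebra is a structure $(A,\oplus,{}^*,0)$ such that $(A,\oplus,0)$ is an abelian monoid and, for all $x,y\in A$, $x^{**}=x$, $(x^*\oplus y)^*\oplus y=(y^*\oplus x)^*\oplus x$ and $0^*\oplus x=0^*$. Put $1=0^*$, $x\odot y=(x^*\oplus y^*)^*$, $x\vee y=(x\odot y^*)\oplus y$, $x\wedge y=(x\oplus y^*)\odot y$, and $x\le y$ iff $x\odot y^*=0$. The partial sum $x+y$ is defined iff $x\odot y=0$, and then $x+y=x\oplus y$. An ideal is a subset that contains $0$, is closed under $\oplus$ and is downward closed; $\mathrm{Rad}(A)$ is the intersection of all maximal (proper) ideals of $A$, and $A$ is semisimple if $\mathrm{Rad}(A)=\{0\}$. A DMV-algebra is an MV-algebra with unary operators $\delta_n$ ($n\ge 1$) such that $n\,\delta_n x=x$ and $\delta_n x\odot (n-1)\delta_n x=0$ for all $x$ (where $k\,y$ is the $k$-fold sum $y\oplus\dots\oplus y$); it is semisimple if its MV-algebra reduct is. A bimorphism $\beta:A\times B\to C$ of MV-algebras is a map with $\beta(1,1)=1$ that preserves $\vee$, $\wedge$ and the partial sum $+$ in each variable. Let $A\otimes_{MV}B$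 be the MV-algebra with the universal bimorphism $A\times B\to A\otimes_{MV}B$, $(a,b)\mapsto a\otimes_{MV}b$, let $A\otimes B=(A\otimes_{MV}B)/\mathrm{Rad}(A\otimes_{MV}B)$ be the semisimple tensor product, and let $a\otimes b$ be the class of $a\otimes_{MV} b$. Let $[0,1]_{\mathbb Q}=[0,1]\cap\mathbb Q$ with $x\oplus y=\min(x+y,1)$ and $x^*=1-x$, and let $\iota_B:B\to[0,1]_{\mathbb Q}\otimes B$, $\iota_B(b)=1\otimes b$. Let $\mathbf{MV_{ss}}$ be the category of semisimple MV-algebras with MV-algebra homomorphisms, $\mathbf{DMV_{ss}}$ the category of semisimple DMV-algebras with DMV-algebra homomorphisms (MV-algebra homomorphisms that commute with all $\delta_n$), and $\mathcal U_\delta:\mathbf{DMV_{ss}}\to\mathbf{MV_{ss}}$ the forgetful functor. Theorem. For every semisimple MV-algebra $B$, the MV-algebra $[0,1]_{\mathbb Q}\otimes B$ is semisimple, and there are operators $\delta_n$ making these algebras DMV-algebras such that for every homomorphism $f:A\to B$ of semisimple MV-algebras there is a unique homomorphism of DMV-algebras $\widetilde f:[0,1]_{\mathbb Q}\otimes A\to[0,1]_{\mathbb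 Q}\otimes B$ with $\widetilde f\circ\iota_A=\iota_B\circ f$. The resulting functor $\mathcal D_\otimes:\mathbf{MV_{ss}}\to\mathbf{DMV_{ss}}$, $\mathcal D_\otimes(B)=[0,1]_{\mathbb Q}\otimes B$, $\mathcal D_\otimes(f)=\widetilde f$, is left adjoint to $\mathcal U_\delta$, by an adjunction whose unit at $B$ is $\iota_B$. -/

import Mathlib

open CategoryTheory

universe u v w

/-! ### MV-algebras -/

/-- An MV-algebra `(A, ⊕, *, 0)`. The operation `⊕` is written `+`, the operation `*` is
written `ᶜ`, and `n • x` is the `n`-fold sum `x ⊕ ⋯ ⊕ x`. -/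
class MVAlgebra (A : Type u) extends AddCommMonoid A, Compl A where
  compl_compl' : ∀ x : A, xᶜᶜ = x
  luk : ∀ x y : A, (xᶜ + y)ᶜ + y = (yᶜ + x)ᶜ + x
  zero_compl_add : ∀ x : A, 0ᶜ + x = 0ᶜ

namespace MV

section Operations

variable {A : Type u} [Add A] [Compl A]

/-- `x ⊙ y = (x* ⊕ y*)*`. -/
def odot (x y : A) : A := (xᶜ + yᶜ)ᶜ

/-- `x ∨ y = (x ⊙ y*) ⊕ y`. -/
def vee (x y : A) : A := odot x yᶜ + y

/-- `x ∧ y = (x ⊕ y*) ⊙ y`. -/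
def wedge (x y : A) : A := odot (x + yᶜ) y

end Operations

/-- The unit `1 = 0*`. -/
def one (A : Type u) [MVAlgebra A] : A := 0ᶜ

/-- The natural order: `x ≤ y` iff `x ⊙ y* = 0`. -/
def le {A : Type u} [MVAlgebra A] (x y : A) : Prop := odot x yᶜ = 0

/-- The partial sum `x + y` is defined iff `x ⊙ y = 0`, and then it equals `x ⊕ y`. -/
def SumDefined {A : Type u} [MVAlgebra A] (x y : A) : Prop := odot x y = 0

end MV

/-- Homomorphisms of MV-algebras. -/
@[ext]
structure MVHom (A : Type u) (B : Type v) [MVAlgebra A] [MVAlgebra B] where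
  toFun : A → B
  map_zero' : toFun 0 = 0
  map_add' : ∀ x y, toFun (x + y) = toFun x + toFun y
  map_compl' : ∀ x, toFun xᶜ = (toFun x)ᶜ

instance MVHom.instFunLike (A : Type u) (B : Type v) [MVAlgebra A] [MVAlgebra B] :
    FunLike (MVHom A B) A B where
  coe := MVHom.toFun
  coe_injective := fun _ _ h => MVHom.ext h

/-! ### DMV-algebras -/

/-- A DMV-algebra structure on an MV-algebra: operators `δ_n`, for the integers `n ≥ 1`, with
`n δ_n x = x` and `δ_n x ⊙ (n - 1) δ_n x = 0`. -/
class DMVAlgebra (A : Type u) [MVAlgebra A] where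
  δ : ℕ+ → A → A
  nsmul_δ : ∀ (n : ℕ+) (x : A), (n : ℕ) • δ n x = x
  δ_odot : ∀ (n : ℕ+) (x : A), MV.odot (δ n x) (((n : ℕ) - 1) • δ n x) = 0

/-- Homomorphisms of DMV-algebras. -/
@[ext]
structure DMVHom (A : Type u) (B : Type v) [MVAlgebra A] [DMVAlgebra A] [MVAlgebra B]
    [DMVAlgebra B] extends MVHom A B where
  map_δ' : ∀ (n : ℕ+) (x : A), toFun (DMVAlgebra.δ n x) = DMVAlgebra.δ n (toFun x)

instance DMVHom.instFunLike (A : Type u) (B : Type v) [MVAlgebra A] [DMVAlgebra A] [MVAlgebra B]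
    [DMVAlgebra B] : FunLike (DMVHom A B) A B where
  coe f := f.toFun
  coe_injective := fun _ _ h => DMVHom.ext h

/-! ### Ideals, radical, semisimplicity, quotients -/

namespace MV

section Ideals

variable {A : Type u} [MVAlgebra A]

/-- Ideals of an MV-algebra. -/
structure IsIdeal (I : Set A) : Prop where
  zero_mem : (0 : A) ∈ I
  add_mem : ∀ {x y : A}, x ∈ I → y ∈ I → x + y ∈ I
  mem_of_le : ∀ {x y : A}, le x y → y ∈ I → x ∈ I

/-- Maximal ideals: maximal among the proper ideals. -/
structure IsMaximalIdeal (I : Set A) : Prop where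
  isIdeal : IsIdeal I
  ne_univ : I ≠ Set.univ
  eq_of_subset : ∀ J : Set A, IsIdeal J → I ⊆ J → J ≠ Set.univ → J = I

/-- The radical: the intersection of all maximal ideals. -/
def rad (A : Type u) [MVAlgebra A] : Set A := {x | ∀ M : Set A, IsMaximalIdeal M → x ∈ M}

/-- An MV-algebra is semisimple if the intersection of its maximal ideals is `{0}`. -/
def IsSemisimple (A : Type u) [MVAlgebra A] : Prop := rad A = {0}

theorem rad_isIdeal : IsIdeal (rad A) where
  zero_mem := fun _ hM => hM.isIdeal.zero_mem
  add_mem := fun hx hy M hM => hM.isIdeal.add_mem (hx M hM) (hy M hM)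
  mem_of_le := fun h hy M hM => hM.isIdeal.mem_of_le h (hy M hM)

theorem cc (x : A) : xᶜᶜ = x := MVAlgebra.compl_compl' x

theorem le_iff {x y : A} : le x y ↔ xᶜ + y = (0 : A)ᶜ := by
  unfold le odot
  rw [cc]
  constructor
  · intro h
    rw [← h, cc]
  · intro h
    rw [h, cc]

theorem compl_add_self (x : A) : xᶜ + x = (0 : A)ᶜ := by
  have h := MVAlgebra.luk ((0 : A)ᶜ) x
  rw [cc, zero_add, add_comm _ (0 : A)ᶜ, MVAlgebra.zero_compl_add] at h
  exact h

theorem le_add_of_eq {x y w : A} (h : y = x + w) : le x y := by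
  rw [le_iff, h, ← add_assoc, compl_add_self, MVAlgebra.zero_compl_add]

theorem odot_le {x y z : A} : le (odot x yᶜ) z ↔ le x (y + z) := by
  rw [le_iff, le_iff]
  unfold odot
  rw [cc, cc, add_assoc]

theorem vee_comm (x y : A) : odot x yᶜ + y = odot y xᶜ + x := by
  unfold odot
  rw [cc, cc]
  exact MVAlgebra.luk x y

theorem odot_triangle (x y z : A) : le (odot x zᶜ) (odot x yᶜ + odot y zᶜ) := by
  rw [odot_le]
  apply le_add_of_eq (w := odot z yᶜ + odot y xᶜ)
  calc z + (odot x yᶜ + odot y zᶜ) = (odot y zᶜ + z) + odot x yᶜ := by abel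
    _ = odot z yᶜ + (odot x yᶜ + y) := by rw [vee_comm y z]; abel
    _ = x + (odot z yᶜ + odot y xᶜ) := by rw [vee_comm x y]; abel

theorem odot_add_le (x y a b : A) :
    le (odot (x + a) (y + b)ᶜ) (odot x yᶜ + odot a bᶜ) := by
  rw [odot_le]
  apply le_add_of_eq (w := odot y xᶜ + odot b aᶜ)
  calc y + b + (odot x yᶜ + odot a bᶜ) = (odot x yᶜ + y) + (odot a bᶜ + b) := by abel
    _ = x + a + (odot y xᶜ + odot b aᶜ) := by rw [vee_comm x y, vee_comm a b]; abel

theorem odot_comm (x y : A) : odot x y = odot y x := by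
  unfold odot
  rw [add_comm]

/-- The congruence of an ideal: `x ≡ y` iff `x ⊙ y*` and `y ⊙ x*` lie in the ideal. -/
def idealSetoid (I : Set A) (hI : IsIdeal I) : Setoid A where
  r x y := odot x yᶜ ∈ I ∧ odot y xᶜ ∈ I
  iseqv :=
    { refl := fun x => by
        have h : odot x xᶜ = 0 := by
          unfold odot
          rw [cc, compl_add_self, cc]
        exact ⟨h ▸ hI.zero_mem, h ▸ hI.zero_mem⟩
      symm := fun h => ⟨h.2, h.1⟩
      trans := fun {x y z} h k =>
        ⟨hI.mem_of_le (odot_triangle x y z) (hI.add_mem h.1 k.1),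
          hI.mem_of_le (odot_triangle z y x) (hI.add_mem k.2 h.2)⟩ }

/-- The quotient MV-algebra `A / I`. -/
def Quot (I : Set A) (hI : IsIdeal I) : Type u := Quotient (idealSetoid I hI)

variable {I : Set A} {hI : IsIdeal I}

/-- The projection `A → A / I`. -/
def Quot.mk (hI : IsIdeal I) (x : A) : Quot I hI := Quotient.mk (idealSetoid I hI) x

instance : Zero (Quot I hI) := ⟨Quot.mk hI 0⟩

instance : Add (Quot I hI) :=
  ⟨Quotient.map₂ (· + ·) (fun x y h a b k =>
    ⟨hI.mem_of_le (odot_add_le x y a b) (hI.add_mem h.1 k.1),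
      hI.mem_of_le (odot_add_le y x b a) (hI.add_mem h.2 k.2)⟩)⟩

instance : Compl (Quot I hI) :=
  ⟨Quotient.map (fun x => xᶜ) (fun x y h => by
    change odot xᶜ yᶜᶜ ∈ I ∧ odot yᶜ xᶜᶜ ∈ I
    rw [cc, cc, odot_comm xᶜ, odot_comm yᶜ]
    exact ⟨h.2, h.1⟩)⟩

instance : MVAlgebra (Quot I hI) where
  add_assoc := by
    rintro ⟨x⟩ ⟨y⟩ ⟨z⟩
    exact congrArg (Quot.mk hI) (add_assoc x y z)
  zero_add := by
    rintro ⟨x⟩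
    exact congrArg (Quot.mk hI) (zero_add x)
  add_zero := by
    rintro ⟨x⟩
    exact congrArg (Quot.mk hI) (add_zero x)
  add_comm := by
    rintro ⟨x⟩ ⟨y⟩
    exact congrArg (Quot.mk hI) (add_comm x y)
  nsmul := nsmulRec
  compl_compl' := by
    rintro ⟨x⟩
    exact congrArg (Quot.mk hI) (cc x)
  luk := by
    rintro ⟨x⟩ ⟨y⟩
    exact congrArg (Quot.mk hI) (MVAlgebra.luk x y)
  zero_compl_add := by
    rintro ⟨x⟩
    exact congrArg (Quot.mk hI) (MVAlgebra.zero_compl_add x)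

end Ideals

/-! ### Bimorphisms and the tensor product -/

/-- Bimorphisms `A × B → C`: maps preserving `∨`, `∧` and the partial sum in each variable
and sending `(1, 1)` to `1`. -/
structure IsBimorphism {A : Type u} {B : Type v} {C : Type w} [MVAlgebra A] [MVAlgebra B]
    [MVAlgebra C] (β : A → B → C) : Prop where
  map_one_one : β (one A) (one B) = one C
  map_vee_left : ∀ x₁ x₂ y, β (vee x₁ x₂) y = vee (β x₁ y) (β x₂ y)
  map_vee_right : ∀ x y₁ y₂, β x (vee y₁ y₂) = vee (β x y₁) (β x y₂)
  map_wedge_left : ∀ x₁ x₂ y, β (wedge x₁ x₂) y = wedge (β x₁ y) (β x₂ y)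
  map_wedge_right : ∀ x y₁ y₂, β x (wedge y₁ y₂) = wedge (β x y₁) (β x y₂)
  sumDefined_left : ∀ x₁ x₂ y, SumDefined x₁ x₂ → SumDefined (β x₁ y) (β x₂ y)
  sumDefined_right : ∀ x y₁ y₂, SumDefined y₁ y₂ → SumDefined (β x y₁) (β x y₂)
  map_add_left : ∀ x₁ x₂ y, SumDefined x₁ x₂ → β (x₁ + x₂) y = β x₁ y + β x₂ y
  map_add_right : ∀ x y₁ y₂, SumDefined y₁ y₂ → β x (y₁ + y₂) = β x y₁ + β x y₂

/-- Terms in the language of MV-algebras over the generators `a ⊗ b`. -/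
inductive TensorTerm (A : Type u) (B : Type v) : Type (max u v)
  | tmul (a : A) (b : B) : TensorTerm A B
  | zero : TensorTerm A B
  | add (s t : TensorTerm A B) : TensorTerm A B
  | compl (s : TensorTerm A B) : TensorTerm A B

namespace TensorTerm

variable {A : Type u} {B : Type v}

instance : Zero (TensorTerm A B) := ⟨zero⟩
instance : Add (TensorTerm A B) := ⟨add⟩
instance : Compl (TensorTerm A B) := ⟨compl⟩

/-- The congruence on terms generated by the axioms of MV-algebras and by the conditions that
make `(a, b) ↦ a ⊗ b` a bimorphism. -/
inductive Rel [MVAlgebra A] [MVAlgebra B] : TensorTerm A B → TensorTerm A B → Prop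
  | refl (s) : Rel s s
  | symm {s t} : Rel s t → Rel t s
  | trans {s t r} : Rel s t → Rel t r → Rel s r
  | add_congr {s s' t t'} : Rel s s' → Rel t t' → Rel (s + t) (s' + t')
  | compl_congr {s s'} : Rel s s' → Rel sᶜ s'ᶜ
  | add_assoc (s t r) : Rel (s + t + r) (s + (t + r))
  | add_comm (s t) : Rel (s + t) (t + s)
  | zero_add (s) : Rel (0 + s) s
  | compl_compl (s) : Rel sᶜᶜ s
  | luk (s t) : Rel ((sᶜ + t)ᶜ + t) ((tᶜ + s)ᶜ + s)
  | zero_compl_add (s) : Rel (0ᶜ + s) 0ᶜ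
  | one_one : Rel (tmul (one A) (one B)) 0ᶜ
  | vee_left (x₁ x₂ y) : Rel (tmul (vee x₁ x₂) y) (vee (tmul x₁ y) (tmul x₂ y))
  | vee_right (x y₁ y₂) : Rel (tmul x (vee y₁ y₂)) (vee (tmul x y₁) (tmul x y₂))
  | wedge_left (x₁ x₂ y) : Rel (tmul (wedge x₁ x₂) y) (wedge (tmul x₁ y) (tmul x₂ y))
  | wedge_right (x y₁ y₂) : Rel (tmul x (wedge y₁ y₂)) (wedge (tmul x y₁) (tmul x y₂))
  | odot_left (x₁ x₂ y) : SumDefined x₁ x₂ → Rel (odot (tmul x₁ y) (tmul x₂ y)) 0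
  | odot_right (x y₁ y₂) : SumDefined y₁ y₂ → Rel (odot (tmul x y₁) (tmul x y₂)) 0
  | add_left (x₁ x₂ y) : SumDefined x₁ x₂ → Rel (tmul (x₁ + x₂) y) (tmul x₁ y + tmul x₂ y)
  | add_right (x y₁ y₂) : SumDefined y₁ y₂ → Rel (tmul x (y₁ + y₂)) (tmul x y₁ + tmul x y₂)

/-- The setoid of the congruence `Rel`. -/
def setoid (A : Type u) (B : Type v) [MVAlgebra A] [MVAlgebra B] : Setoid (TensorTerm A B) where
  r := Rel
  iseqv := ⟨Rel.refl, Rel.symm, Rel.trans⟩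

end TensorTerm

/-- The MV-algebraic tensor product `A ⊗_MV B`: the MV-algebra generated by the symbols `a ⊗ b`
subject to the conditions that make `(a, b) ↦ a ⊗ b` a bimorphism. -/
def Tensor (A : Type u) (B : Type v) [MVAlgebra A] [MVAlgebra B] : Type (max u v) :=
  Quotient (TensorTerm.setoid A B)

namespace Tensor

variable {A : Type u} {B : Type v} [MVAlgebra A] [MVAlgebra B]

/-- The class of a term. -/
def mk (s : TensorTerm A B) : Tensor A B := Quotient.mk (TensorTerm.setoid A B) s

/-- The universal bimorphism `β_{A,B} : (a, b) ↦ a ⊗_MV b`. -/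
def tmul (a : A) (b : B) : Tensor A B := mk (TensorTerm.tmul a b)

instance : Zero (Tensor A B) := ⟨mk 0⟩

instance : Add (Tensor A B) :=
  ⟨Quotient.map₂ (· + ·) (fun _ _ h _ _ k => TensorTerm.Rel.add_congr h k)⟩

instance : Compl (Tensor A B) :=
  ⟨Quotient.map (fun s => sᶜ) (fun _ _ h => TensorTerm.Rel.compl_congr h)⟩

theorem mk_eq {s t : TensorTerm A B} (h : TensorTerm.Rel s t) : mk s = mk t :=
  Quotient.sound (s := TensorTerm.setoid A B) h

instance : MVAlgebra (Tensor A B) where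
  add_assoc := by
    rintro ⟨x⟩ ⟨y⟩ ⟨z⟩
    exact mk_eq (.add_assoc x y z)
  zero_add := by
    rintro ⟨x⟩
    exact mk_eq (.zero_add x)
  add_zero := by
    rintro ⟨x⟩
    exact mk_eq ((TensorTerm.Rel.add_comm x 0).trans (.zero_add x))
  add_comm := by
    rintro ⟨x⟩ ⟨y⟩
    exact mk_eq (.add_comm x y)
  nsmul := nsmulRec
  compl_compl' := by
    rintro ⟨x⟩
    exact mk_eq (.compl_compl x)
  luk := by
    rintro ⟨x⟩ ⟨y⟩
    exact mk_eq (.luk x y)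
  zero_compl_add := by
    rintro ⟨x⟩
    exact mk_eq (.zero_compl_add x)

theorem tmul_isBimorphism : IsBimorphism (tmul : A → B → Tensor A B) where
  map_one_one := mk_eq .one_one
  map_vee_left x₁ x₂ y := mk_eq (.vee_left x₁ x₂ y)
  map_vee_right x y₁ y₂ := mk_eq (.vee_right x y₁ y₂)
  map_wedge_left x₁ x₂ y := mk_eq (.wedge_left x₁ x₂ y)
  map_wedge_right x y₁ y₂ := mk_eq (.wedge_right x y₁ y₂)
  sumDefined_left x₁ x₂ y h := mk_eq (.odot_left x₁ x₂ y h)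
  sumDefined_right x y₁ y₂ h := mk_eq (.odot_right x y₁ y₂ h)
  map_add_left x₁ x₂ y h := mk_eq (.add_left x₁ x₂ y h)
  map_add_right x y₁ y₂ h := mk_eq (.add_right x y₁ y₂ h)

/-- Evaluation of terms along a map `A × B → C`. -/
def eval {C : Type w} [MVAlgebra C] (γ : A → B → C) : TensorTerm A B → C
  | .tmul a b => γ a b
  | .zero => 0
  | .add s t => eval γ s + eval γ t
  | .compl s => (eval γ s)ᶜ

theorem eval_rel {C : Type w} [MVAlgebra C] {γ : A → B → C} (hγ : IsBimorphism γ)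
    {s t : TensorTerm A B} (h : TensorTerm.Rel s t) : eval γ s = eval γ t := by
  induction h with
  | refl s => rfl
  | symm _ ih => exact ih.symm
  | trans _ _ ih₁ ih₂ => exact ih₁.trans ih₂
  | add_congr _ _ ih₁ ih₂ => exact congrArg₂ (· + ·) ih₁ ih₂
  | compl_congr _ ih => exact congrArg (fun c => cᶜ) ih
  | add_assoc s t r => exact _root_.add_assoc (eval γ s) (eval γ t) (eval γ r)
  | add_comm s t => exact _root_.add_comm (eval γ s) (eval γ t)
  | zero_add s => exact _root_.zero_add (eval γ s)
  | compl_compl s => exact cc (eval γ s)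
  | luk s t => exact MVAlgebra.luk (eval γ s) (eval γ t)
  | zero_compl_add s => exact MVAlgebra.zero_compl_add (eval γ s)
  | one_one => exact hγ.map_one_one
  | vee_left x₁ x₂ y => exact hγ.map_vee_left x₁ x₂ y
  | vee_right x y₁ y₂ => exact hγ.map_vee_right x y₁ y₂
  | wedge_left x₁ x₂ y => exact hγ.map_wedge_left x₁ x₂ y
  | wedge_right x y₁ y₂ => exact hγ.map_wedge_right x y₁ y₂
  | odot_left x₁ x₂ y h => exact hγ.sumDefined_left x₁ x₂ y h
  | odot_right x y₁ y₂ h => exact hγ.sumDefined_right x y₁ y₂ h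
  | add_left x₁ x₂ y h => exact hγ.map_add_left x₁ x₂ y h
  | add_right x y₁ y₂ h => exact hγ.map_add_right x y₁ y₂ h

/-- The defining universal property of the tensor product. -/
theorem existsUnique_lift {C : Type w} [MVAlgebra C] {γ : A → B → C} (hγ : IsBimorphism γ) :
    ∃! ω : MVHom (Tensor A B) C, ∀ a b, ω (tmul a b) = γ a b := by
  refine ⟨⟨Quotient.lift (eval γ) (fun _ _ h => eval_rel hγ h), rfl, ?_, ?_⟩, fun _ _ => rfl, ?_⟩
  · rintro ⟨x⟩ ⟨y⟩
    rfl
  · rintro ⟨x⟩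
    rfl
  · intro ω hω
    apply MVHom.ext
    funext x
    obtain ⟨s, rfl⟩ := Quotient.exists_rep x
    change ω.toFun (mk s) = eval γ s
    induction s with
    | tmul a b => exact hω a b
    | zero => exact ω.map_zero'
    | add s t ihs iht =>
      exact (ω.map_add' (mk s) (mk t)).trans (congrArg₂ (· + ·) ihs iht)
    | compl s ih => exact (ω.map_compl' (mk s)).trans (congrArg (fun c => cᶜ) ih)

end Tensor

/-- The semisimple tensor product `A ⊗ B = (A ⊗_MV B) / Rad (A ⊗_MV B)`. -/
abbrev SSTensor (A : Type u) (B : Type v) [MVAlgebra A] [MVAlgebra B] : Type (max u v) :=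
  Quot (rad (Tensor A B)) rad_isIdeal

/-- `a ⊗ b`, the class of `a ⊗_MV b` in the semisimple tensor product. -/
def stmul {A : Type u} {B : Type v} [MVAlgebra A] [MVAlgebra B] (a : A) (b : B) :
    SSTensor A B :=
  Quot.mk rad_isIdeal (Tensor.tmul a b)

end MV

/-! ### The MV-algebra of rationals in the unit interval -/

/-- `[0,1]_ℚ = [0,1] ∩ ℚ`. -/
def RatUnit : Type := {q : ℚ // 0 ≤ q ∧ q ≤ 1}

namespace RatUnit

instance : Zero RatUnit := ⟨⟨0, le_refl 0, zero_le_one⟩⟩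

instance : Add RatUnit :=
  ⟨fun x y => ⟨min (x.1 + y.1) 1, le_min (add_nonneg x.2.1 y.2.1) zero_le_one, min_le_right _ _⟩⟩

instance : Compl RatUnit := ⟨fun x => ⟨1 - x.1, sub_nonneg.2 x.2.2, sub_le_self 1 x.2.1⟩⟩

/-- `x ⊕ y = min (x + y) 1` and `x* = 1 - x`. -/
instance : MVAlgebra RatUnit where
  add_assoc := by
    rintro ⟨x, hx, hx'⟩ ⟨y, hy, hy'⟩ ⟨z, hz, hz'⟩
    apply Subtype.ext
    change min (min (x + y) 1 + z) 1 = min (x + min (y + z) 1) 1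
    grind
  zero_add := by
    rintro ⟨x, hx, hx'⟩
    apply Subtype.ext
    change min (0 + x) 1 = x
    grind
  add_zero := by
    rintro ⟨x, hx, hx'⟩
    apply Subtype.ext
    change min (x + 0) 1 = x
    grind
  add_comm := by
    rintro ⟨x, hx, hx'⟩ ⟨y, hy, hy'⟩
    apply Subtype.ext
    change min (x + y) 1 = min (y + x) 1
    grind
  nsmul := nsmulRec
  compl_compl' := by
    rintro ⟨x, hx, hx'⟩
    apply Subtype.ext
    change 1 - (1 - x) = x
    grind
  luk := by
    rintro ⟨x, hx, hx'⟩ ⟨y, hy, hy'⟩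
    apply Subtype.ext
    change min (1 - min (1 - x + y) 1 + y) 1 = min (1 - min (1 - y + x) 1 + x) 1
    grind
  zero_compl_add := by
    rintro ⟨x, hx, hx'⟩
    apply Subtype.ext
    change min (1 - 0 + x) 1 = 1 - 0
    grind

end RatUnit

/-! ### The categories and the functors -/

/-- Semisimple MV-algebras. -/
structure MVss : Type (u + 1) where
  carrier : Type u
  [mv : MVAlgebra carrier]
  semisimple : MV.IsSemisimple carrier

namespace MVss

instance : CoeSort MVss.{u} (Type u) := ⟨MVss.carrier⟩

instance (A : MVss.{u}) : MVAlgebra A := A.mv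

/-- The category of semisimple MV-algebras and MV-algebra homomorphisms. -/
instance : Category MVss.{u} where
  Hom A B := MVHom A B
  id _ := ⟨fun x => x, rfl, fun _ _ => rfl, fun _ => rfl⟩
  comp f g :=
    ⟨fun x => MVHom.toFun g (MVHom.toFun f x),
      by rw [f.map_zero', g.map_zero'],
      fun x y => by rw [f.map_add', g.map_add'],
      fun x => by rw [f.map_compl', g.map_compl']⟩

instance : ConcreteCategory MVss.{u} (fun A B => MVHom A B) where
  hom f := f
  ofHom f := f

end MVss

/-- Semisimple DMV-algebras: DMV-algebras whose MV-algebra reduct is semisimple. -/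
structure DMVss : Type (u + 1) where
  carrier : Type u
  [mv : MVAlgebra carrier]
  [dmv : DMVAlgebra carrier]
  semisimple : MV.IsSemisimple carrier

namespace DMVss

instance : CoeSort DMVss.{u} (Type u) := ⟨DMVss.carrier⟩

instance (A : DMVss.{u}) : MVAlgebra A := A.mv

instance (A : DMVss.{u}) : DMVAlgebra A := A.dmv

/-- The category of semisimple DMV-algebras and DMV-algebra homomorphisms. -/
instance : Category DMVss.{u} where
  Hom A B := DMVHom A B
  id _ := ⟨⟨fun x => x, rfl, fun _ _ => rfl, fun _ => rfl⟩, fun _ _ => rfl⟩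
  comp f g :=
    ⟨⟨fun x => g.toFun (f.toFun x),
      by rw [f.map_zero', g.map_zero'],
      fun x y => by rw [f.map_add', g.map_add'],
      fun x => by rw [f.map_compl', g.map_compl']⟩,
      fun n x => by
        change g.toFun (f.toFun _) = _
        rw [f.map_δ', g.map_δ']⟩

instance : ConcreteCategory DMVss.{u} (fun A B => DMVHom A B) where
  hom f := f
  ofHom f := f

/-- The forgetful functor from semisimple DMV-algebras to semisimple MV-algebras. -/
def forgetδ : DMVss.{u} ⥤ MVss.{u} where
  obj V := ⟨V.carrier, V.semisimple⟩
  map f := DMVHom.toMVHom f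

end DMVss

/-- The semisimple tensor product `[0,1]_ℚ ⊗ B`. -/
abbrev RatTensor (B : Type u) [MVAlgebra B] : Type u := MV.SSTensor RatUnit B

/-- The map `ι_B : B → [0,1]_ℚ ⊗ B`, `b ↦ 1 ⊗ b`. -/
def RatTensor.ι (B : Type u) [MVAlgebra B] (b : B) : RatTensor B := MV.stmul (MV.one RatUnit) b

/-- Once `[0,1]_ℚ ⊗ B` is known to be semisimple and carries operators `δ_n`, it is an object of
the category of semisimple DMV-algebras. -/
abbrev RatTensor.obj (hss : ∀ B : MVss.{u}, MV.IsSemisimple (RatTensor B))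
    (δ : ∀ B : MVss.{u}, DMVAlgebra (RatTensor B)) (B : MVss.{u}) : DMVss.{u} :=
  { carrier := RatTensor B, dmv := δ B, semisimple := hss B }

/-- The functor `D_⊗`: on objects `B ↦ [0,1]_ℚ ⊗ B`; a homomorphism `f : A → B` is sent to the
unique homomorphism `g` of DMV-algebras with `g ∘ ι_A = ι_B ∘ f`. -/
noncomputable def Dtensor (hss : ∀ B : MVss.{u}, MV.IsSemisimple (RatTensor B))
    (δ : ∀ B : MVss.{u}, DMVAlgebra (RatTensor B))
    (hmap : ∀ (A B : MVss.{u}) (f : A ⟶ B),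
      ∃! g : RatTensor.obj hss δ A ⟶ RatTensor.obj hss δ B,
        ∀ a : A, g (RatTensor.ι A a) = RatTensor.ι B (f a)) :
    MVss.{u} ⥤ DMVss.{u} where
  obj B := RatTensor.obj hss δ B
  map {A B} f := (hmap A B f).choose
  map_id A := (hmap A A (𝟙 A)).unique (hmap A A (𝟙 A)).choose_spec.1 (fun _ => rfl)
  map_comp {A B C} f g := by
    refine (hmap A C (f ≫ g)).unique (hmap A C (f ≫ g)).choose_spec.1 (fun a => ?_)
    exact (congrArg _ ((hmap A B f).choose_spec.1 a)).trans ((hmap B C g).choose_spec.1 (f a))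

/-! A semisimple MV-algebra is separated by its characters, the homomorphisms to the real interval
`[0, 1]`, so equations and defined sums in it can be checked on real numbers (`IsSemisimple.ext`).
This rests on `IsMaximalIdeal.exists_character`: the quotient by a maximal ideal is linearly ordered
and Archimedean, and counting how many copies of a small element are needed to cover `x`, relative
to `1`, gives in Hölder's manner an additive real function on it.

Under a character `δ n` is forced to be division by `n`. Hence every MV-homomorphism into a
semisimple DMV-algebra preserves the division operators automatically.

For a character `φ` of `[0,1]_ℚ ⊗ B`, additivity in the rational variable gives `φ (q ⊗ b) = q * φ
(1 ⊗ b)`, and `b ↦ φ (1 ⊗ b)` is again a character. So `ι_B` is a homomorphism, and homomorphisms to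
semisimple algebras are determined on its image. Division by `n` exists on each `q ⊗ b`, as `(q / n)
⊗ b`, and passes through sums and complements (`RatTensor.exists_div`).

A homomorphism `f : B → D` to a semisimple DMV-algebra extends because `(q, b) ↦ q f(b)` is a
bimorphism; its lift to `⊗_MV` kills the radical. This makes `ι_B` a universal arrow, which yields
both the functor and the adjunction. -/

namespace MV

/-! ### Order and residuation in MV-algebras. -/

section Order

variable {A : Type u} [MVAlgebra A]

theorem add_one (x : A) : x + (0 : A)ᶜ = (0 : A)ᶜ := by
  rw [add_comm, MVAlgebra.zero_compl_add]

theorem odot_compl_self (x : A) : odot x xᶜ = 0 := by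
  unfold odot
  rw [cc, compl_add_self, cc]

theorem odot_assoc (x y z : A) : odot (odot x y) z = odot x (odot y z) := by
  unfold odot
  rw [cc, cc, add_assoc]

theorem odot_zero (x : A) : odot x 0 = 0 := by
  unfold odot
  rw [add_one, cc]

theorem odot_one (x : A) : odot x (0 : A)ᶜ = x := by
  unfold odot
  rw [cc, add_zero, cc]

theorem zero_odot (x : A) : odot 0 x = 0 := by
  rw [odot_comm, odot_zero]

theorem odot_eq_zero_iff {x y : A} : odot x y = 0 ↔ le x yᶜ := by
  unfold le
  rw [cc]

theorem le.refl (x : A) : le x x := odot_compl_self x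

theorem zero_le' (x : A) : le 0 x := zero_odot _

theorem le_one (x : A) : le x (0 : A)ᶜ := by
  rw [le_iff, add_one]

theorem le.trans {x y z : A} (h : le x y) (k : le y z) : le x z := by
  have ht := odot_triangle x y z
  rw [show odot x yᶜ = 0 from h, show odot y zᶜ = 0 from k, add_zero] at ht
  have h0 := le_iff.1 ht
  rw [add_zero] at h0
  calc odot x zᶜ = ((odot x zᶜ)ᶜ)ᶜ := (cc _).symm
    _ = 0 := by rw [h0, cc]

theorem eq_add_of_le {x y : A} (h : le x y) : y = x + odot y xᶜ := by
  have hv := vee_comm x y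
  rw [show odot x yᶜ = 0 from h, zero_add] at hv
  exact hv.trans (add_comm _ _)

theorem le.antisymm {x y : A} (h : le x y) (k : le y x) : x = y := by
  have hv := vee_comm x y
  rw [show odot x yᶜ = 0 from h, show odot y xᶜ = 0 from k, zero_add, zero_add] at hv
  exact hv.symm

theorem le_zero {x : A} (h : le x 0) : x = 0 := h.antisymm (zero_le' x)

theorem one_le {x : A} (h : le (0 : A)ᶜ x) : x = (0 : A)ᶜ := (le_one x).antisymm h

theorem le_add_right (x y : A) : le x (x + y) := le_add_of_eq rfl

theorem le.add {x y a b : A} (h : le x y) (k : le a b) : le (x + a) (y + b) := by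
  have := odot_add_le x y a b
  rw [show odot x yᶜ = 0 from h, show odot a bᶜ = 0 from k, add_zero] at this
  exact le_zero this

theorem le.compl {x y : A} (h : le x y) : le yᶜ xᶜ := by
  rw [le_iff, cc, add_comm]
  exact le_iff.1 h

theorem odot_le_left (x y : A) : le (odot x y) x := by
  rw [← cc y, odot_le]
  rw [add_comm]
  exact le_add_right _ _

theorem odot_le_right (x y : A) : le (odot x y) y := by
  rw [odot_comm]
  exact odot_le_left y x

theorem le.odot {x y : A} (h : le x y) (z : A) : le (odot x z) (odot y z) :=
  (h.compl.add (le.refl zᶜ)).compl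

/-- The meet as a residual: `x ⊙ (x* ⊕ y) = y ⊙ (y* ⊕ x)`. -/
theorem odot_compl_add_comm (x y : A) : odot x (xᶜ + y) = odot y (yᶜ + x) := by
  unfold odot
  have h := vee_comm xᶜ yᶜ
  unfold odot at h
  simp only [cc] at h
  rw [add_comm xᶜ (xᶜ + y)ᶜ, add_comm yᶜ (yᶜ + x)ᶜ, add_comm xᶜ y, add_comm yᶜ x, ← h]

theorem odot_compl_add_le (x y : A) : le (odot x (xᶜ + y)) y := by
  rw [odot_compl_add_comm]
  exact odot_le_left _ _

/-- This is `(x ⊙ y*) ∧ (y ⊙ x*) = 0`. Two uses of the commutativity of the residual form of the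
meet bring the element below `(y ∧ w*) ⊙ x*`, where `w* ≤ x`, hence below `x ⊙ x* = 0`. -/
theorem prelinear (x y : A) :
    odot (odot x yᶜ) ((odot x yᶜ)ᶜ + odot y xᶜ) = 0 := by
  set v := odot y xᶜ with hv
  set w := xᶜ + v with hw
  have h₁ : odot (odot x yᶜ) ((odot x yᶜ)ᶜ + v) = odot (odot v (vᶜ + x)) (wᶜ + yᶜ) := by
    have : (odot x yᶜ)ᶜ + v = yᶜᶜ + w := by
      unfold odot
      rw [cc, hw]
      abel
    rw [this, odot_assoc, odot_compl_add_comm yᶜ w, ← odot_assoc, hw, odot_compl_add_comm x v]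
  rw [h₁]
  refine le_zero (((odot_le_left _ _).odot _).trans ?_)
  rw [hv, odot_comm y xᶜ, odot_assoc, odot_comm xᶜ, add_comm wᶜ, ← odot_compl_self x]
  refine le.odot ((odot_compl_add_le _ _).trans ?_) _
  have := (le_add_right xᶜ v).compl
  rwa [cc] at this

theorem sub_eq_self_of_disjoint {u v : A} (h : odot u (uᶜ + v) = 0) : odot v uᶜ = v := by
  refine (odot_le_left _ _).antisymm ?_
  rw [odot_compl_add_comm] at h
  have h' := odot_eq_zero_iff.1 h
  unfold odot at h' ⊢
  rwa [cc]

theorem sub_nsmul_eq_self {u v : A} (h : odot v uᶜ = v) (n : ℕ) : odot v (n • u)ᶜ = v := by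
  induction n with
  | zero => rw [zero_nsmul, odot_one]
  | succ n ih =>
    have : (n • u + u)ᶜ = odot (n • u)ᶜ uᶜ := by
      unfold odot
      rw [cc, cc]
    rw [succ_nsmul, this, ← odot_assoc, ih, h]

theorem add_nsmul_eq_self {e y : A} (h : e + y = y) (n : ℕ) : n • e + y = y := by
  induction n with
  | zero => rw [zero_nsmul, zero_add]
  | succ n ih => rw [succ_nsmul, add_assoc, h, ih]

theorem nsmul_le_nsmul_left {k n : ℕ} (h : k ≤ n) (x : A) : le (k • x) (n • x) := by
  obtain ⟨m, rfl⟩ := Nat.exists_eq_add_of_le h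
  rw [add_nsmul]
  exact le_add_right _ _

theorem nsmul_le_nsmul_right {x y : A} (h : le x y) (n : ℕ) : le (n • x) (n • y) := by
  induction n with
  | zero => rw [zero_nsmul, zero_nsmul]; exact le.refl _
  | succ n ih => rw [succ_nsmul, succ_nsmul]; exact ih.add h

end Order

/-! ### Simple MV-algebras: linear order and counting. -/

section Simple

/-- A nontrivial MV-algebra in which every nonzero element has a multiple equal to `1`. -/
structure IsSimple (A : Type u) [MVAlgebra A] : Prop where
  zero_ne_one : (0 : A) ≠ (0 : A)ᶜ
  exists_nsmul : ∀ x : A, x ≠ 0 → ∃ n : ℕ, n • x = (0 : A)ᶜ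

variable {A : Type u} [MVAlgebra A]

namespace IsSimple

/-- By prelinearity, subtracting any multiple of `x ⊙ y*` leaves `y ⊙ x*` unchanged. If `x ⊙ y* ≠
0`, some multiple of it is `1`, and subtracting `1` gives `0`. -/
theorem le_total (hA : IsSimple A) (x y : A) : le x y ∨ le y x := by
  by_cases h : odot x yᶜ = 0
  · exact Or.inl h
  · right
    obtain ⟨n, hn⟩ := hA.exists_nsmul _ h
    have := sub_nsmul_eq_self (sub_eq_self_of_disjoint (prelinear x y)) n
    rw [hn, cc, odot_zero] at this
    exact this.symm

theorem eq_one_of_add_eq (hA : IsSimple A) {e y : A} (he : e ≠ 0) (h : e + y = y) :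
    y = (0 : A)ᶜ := by
  obtain ⟨n, hn⟩ := hA.exists_nsmul e he
  have := add_nsmul_eq_self h n
  rwa [hn, MVAlgebra.zero_compl_add, eq_comm] at this

end IsSimple

/-- The least number of copies of `e` whose sum dominates `x`. -/
noncomputable def count (e x : A) : ℕ := sInf {k : ℕ | le x (k • e)}

theorem count_le {e x : A} {k : ℕ} (h : le x (k • e)) : count e x ≤ k := Nat.sInf_le h

namespace IsSimple

theorem le_count (hA : IsSimple A) {e : A} (he : e ≠ 0) (x : A) : le x (count e x • e) := by
  obtain ⟨n, hn⟩ := hA.exists_nsmul e he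
  exact Nat.sInf_mem (s := {k : ℕ | le x (k • e)}) ⟨n, by
    change le x (n • e)
    rw [hn]
    exact le_one x⟩

theorem count_mono (hA : IsSimple A) {e : A} (he : e ≠ 0) {x y : A} (h : le x y) :
    count e x ≤ count e y := count_le (h.trans (hA.le_count he y))

theorem count_add_le (hA : IsSimple A) {e : A} (he : e ≠ 0) (x y : A) :
    count e (x + y) ≤ count e x + count e y := by
  apply count_le
  rw [add_nsmul]
  exact (hA.le_count he x).add (hA.le_count he y)

theorem nsmul_le_of_lt_count (hA : IsSimple A) {e x : A} {k : ℕ} (h : k < count e x) :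
    le (k • e) x :=
  (hA.le_total _ _).resolve_right fun h' => (count_le h').not_gt h

/-- If `a > k e`, `b > l e` and `a + b` is defined, then `(k + l) e ≠ 1`. -/
theorem nsmul_ne_one_of_lt_count (hA : IsSimple A) {e a b : A} {k l : ℕ} (hab : odot a b = 0)
    (hk : k < count e a) (hl : l < count e b) : (k + l) • e ≠ (0 : A)ᶜ := by
  intro h
  have h₁ : le (l • e)ᶜ (k • e) := by
    rw [le_iff, cc, add_comm, ← add_nsmul, h]
  have h₂ : le a (l • e)ᶜ :=
    (odot_eq_zero_iff.1 hab).trans (hA.nsmul_le_of_lt_count hl).compl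
  exact (count_le (h₂.trans h₁)).not_gt hk

/-- Each count overshoots by at most one copy of `e`, whence the error `2`. A larger defect would
let some multiple of `e` absorb a further copy; in a simple algebra that multiple is then `1`, which
definedness of the sum excludes. -/
theorem le_count_add (hA : IsSimple A) {e : A} (he : e ≠ 0) {a b : A} (hab : odot a b = 0) :
    count e a + count e b ≤ count e (a + b) + 2 := by
  by_contra! hlt
  have hma := hA.count_mono he (le_add_right a b)
  have hmb := hA.count_mono he (le_add_right b a)
  rw [add_comm b a] at hmb
  obtain ⟨k, hk⟩ : ∃ k, count e a = k + 1 := Nat.exists_eq_succ_of_ne_zero (by omega)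
  obtain ⟨l, hl⟩ : ∃ l, count e b = l + 1 := Nat.exists_eq_succ_of_ne_zero (by omega)
  obtain ⟨m, hm⟩ : ∃ m, k + l = m + 1 := Nat.exists_eq_succ_of_ne_zero (by omega)
  have hka : k < count e a := by omega
  have hlb : l < count e b := by omega
  have hne := hA.nsmul_ne_one_of_lt_count hab hka hlb
  have h₁ : le ((k + l) • e) (m • e) := by
    rw [add_nsmul]
    refine ((hA.nsmul_le_of_lt_count hka).add (hA.nsmul_le_of_lt_count hlb)).trans ((hA.le_count he (a + b)).trans ?_)
    exact nsmul_le_nsmul_left (by omega) e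
  rw [hm] at h₁ hne
  have h₂ : e + m • e = m • e := by
    rw [← succ_nsmul']
    exact h₁.antisymm (nsmul_le_nsmul_left (by omega) e)
  have h₃ := hA.eq_one_of_add_eq he h₂
  exact hne (by rw [succ_nsmul', h₂, h₃])

theorem count_one_pos (hA : IsSimple A) {e : A} (he : e ≠ 0) : 0 < count e (0 : A)ᶜ := by
  by_contra! h
  have := hA.le_count he (0 : A)ᶜ
  rw [Nat.le_zero.1 h, zero_nsmul] at this
  exact hA.zero_ne_one (le_zero this).symm

/-- Removing one copy fewer than the count leaves a nonzero remainder, which dominates the least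
nonzero element `e`. -/
theorem eq_count_nsmul_of_atom (hA : IsSimple A) {e : A} (he : e ≠ 0)
    (hmin : ∀ x : A, x ≠ 0 → le e x) (a : A) : a = count e a • e := by
  refine (hA.le_count he a).antisymm ?_
  rcases Nat.eq_zero_or_pos (count e a) with h0 | hpos
  · rw [h0, zero_nsmul]
    exact zero_le' a
  obtain ⟨k, hk⟩ := Nat.exists_eq_succ_of_ne_zero hpos.ne'
  have hlt : k < count e a := by omega
  have hne : odot a (k • e)ᶜ ≠ 0 := fun h => (count_le h).not_gt hlt
  rw [hk, Nat.succ_eq_add_one, succ_nsmul]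
  conv => rhs; rw [eq_add_of_le (hA.nsmul_le_of_lt_count hlt)]
  exact (le.refl _).add (hmin _ hne)

/-- With `a = (k + 1) e` and `b = l e`, a strict defect forces `(k + l) e = 1`. Then `a ≤ b* ≤ k e`,
contradicting the minimality of the count. -/
theorem count_add_of_atom (hA : IsSimple A) {e : A} (he : e ≠ 0)
    (hmin : ∀ x : A, x ≠ 0 → le e x) {a b : A} (hab : odot a b = 0) :
    count e (a + b) = count e a + count e b := by
  refine (hA.count_add_le he a b).antisymm ?_
  by_contra! hlt
  have hma := hA.count_mono he (le_add_right a b)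
  have hmb := hA.count_mono he (le_add_right b a)
  rw [add_comm b a] at hmb
  obtain ⟨k, hk⟩ : ∃ k, count e a = k + 1 := Nat.exists_eq_succ_of_ne_zero (by omega)
  have ha := hA.eq_count_nsmul_of_atom he hmin a
  have hb := hA.eq_count_nsmul_of_atom he hmin b
  set l := count e b with hl
  have h₁ : le ((k + l + 1) • e) ((k + l) • e) := by
    rw [show k + l + 1 = count e a + l by omega, add_nsmul, ← ha, ← hb]
    exact (hA.le_count he (a + b)).trans (nsmul_le_nsmul_left (by omega) e)
  have h₂ : e + (k + l) • e = (k + l) • e := by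
    rw [← succ_nsmul']
    exact h₁.antisymm (nsmul_le_nsmul_left (by omega) e)
  have h₃ := hA.eq_one_of_add_eq he h₂
  have h₄ : le a (k • e) := by
    refine (odot_eq_zero_iff.1 hab).trans ?_
    rw [le_iff, cc, hb, add_comm, ← add_nsmul, h₃]
  exact (count_le h₄).not_gt (by omega)

end IsSimple
end Simple
end MV

/-! ### States on simple algebras, and characters. -/

namespace MV

variable {A : Type u} [MVAlgebra A]

/-- States: normalized, nonnegative functions that are additive on the partial sum. -/
structure IsState (s : A → ℝ) : Prop where
  nonneg : ∀ x, 0 ≤ s x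
  map_one : s (0 : A)ᶜ = 1
  map_add : ∀ x y, odot x y = 0 → s (x + y) = s x + s y

namespace IsSimple

theorem isState_of_atom (hA : IsSimple A) {e : A} (he : e ≠ 0)
    (hmin : ∀ x : A, x ≠ 0 → le e x) :
    IsState fun x : A => (count e x : ℝ) / count e (0 : A)ᶜ where
  nonneg x := by positivity
  map_one := div_self (Nat.cast_ne_zero.2 (hA.count_one_pos he).ne')
  map_add x y h := by
    rw [hA.count_add_of_atom he hmin h]
    push_cast
    ring

theorem exists_half (hA : IsSimple A) (hno : ∀ e : A, e ≠ 0 → ∃ x : A, x ≠ 0 ∧ ¬ le e x)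
    {e : A} (he : e ≠ 0) : ∃ d : A, d ≠ 0 ∧ le (d + d) e := by
  obtain ⟨x, hx, hex⟩ := hno e he
  have hxe := eq_add_of_le ((hA.le_total e x).resolve_left hex)
  -- Here `e = x + y`, so twice the smaller summand lies below `e`.
  set y := odot e xᶜ
  rcases hA.le_total x y with h | h
  · exact ⟨x, hx, hxe ▸ (le.refl x).add h⟩
  · exact ⟨y, hex, hxe ▸ h.add (le.refl y)⟩

theorem exists_nsmul_ne_one (hA : IsSimple A)
    (hno : ∀ e : A, e ≠ 0 → ∃ x : A, x ≠ 0 ∧ ¬ le e x) (n : ℕ) :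
    ∃ e : A, e ≠ 0 ∧ (2 ^ n) • e ≠ (0 : A)ᶜ := by
  induction n with
  | zero =>
    obtain ⟨x, hx, h⟩ := hno (0 : A)ᶜ hA.zero_ne_one.symm
    exact ⟨x, hx, fun h' => h (by rw [← h', pow_zero, one_nsmul]; exact le.refl x)⟩
  | succ n ih =>
    obtain ⟨e, he, hne⟩ := ih
    obtain ⟨d, hd, hde⟩ := hA.exists_half hno he
    refine ⟨d, hd, fun h => hne (one_le ?_)⟩
    rw [← h, pow_succ, mul_nsmul', two_nsmul]
    exact nsmul_le_nsmul_right hde _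

/-- Repeated halving gives units `e n` with `count (e n) 1 ≥ 2 ^ n`. The normalized counts are
additive up to `2 / 2 ^ n`, so any limit of them is exactly additive. -/
theorem exists_state_of_no_atom (hA : IsSimple A)
    (hno : ∀ e : A, e ≠ 0 → ∃ x : A, x ≠ 0 ∧ ¬ le e x) : ∃ s : A → ℝ, IsState s := by
  choose e he hne using hA.exists_nsmul_ne_one hno
  have hcount : ∀ n, 2 ^ n ≤ count (e n) (0 : A)ᶜ := fun n => by
    by_contra! h
    refine hne n (one_le ((hA.le_count (he n) _).trans (nsmul_le_nsmul_left h.le _)))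
  have hpos : ∀ n, (0 : ℝ) < count (e n) (0 : A)ᶜ := fun n =>
    Nat.cast_pos.2 (hA.count_one_pos (he n))
  set r : A → ℕ → ℝ := fun x n => (count (e n) x : ℝ) / count (e n) (0 : A)ᶜ with hr
  have hmem : ∀ x n, r x n ∈ Set.Icc (0 : ℝ) 1 := fun x n =>
    ⟨by positivity, (div_le_one (hpos n)).2
      (Nat.cast_le.2 (hA.count_mono (he n) (le_one x)))⟩
  -- Compactness supplies limits along an ultrafilter, so convergence of the ratios need not be
  -- proved. The ultrafilter is nonprincipal, so the error bound tends to `0` along it.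
  have hlim : ∀ x, ∃ L ∈ Set.Icc (0 : ℝ) 1,
      Filter.Tendsto (r x) (Filter.hyperfilter ℕ) (nhds L) := fun x =>
    isCompact_Icc.ultrafilter_le_nhds ((Filter.hyperfilter ℕ).map (r x))
      (Filter.le_principal_iff.2 (Filter.mem_map.2 (Filter.univ_mem' (hmem x))))
  choose s hs hst using hlim
  have hle : ((Filter.hyperfilter ℕ : Ultrafilter ℕ) : Filter ℕ) ≤ Filter.atTop :=
    Nat.hyperfilter_le_atTop
  have herr : Filter.Tendsto (fun n : ℕ => 2 * ((1 : ℝ) / 2) ^ n)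
      (Filter.hyperfilter ℕ) (nhds 0) := by
    have := (tendsto_pow_atTop_nhds_zero_of_lt_one (r := (1 / 2 : ℝ)) (by norm_num)
      (by norm_num)).const_mul 2
    rw [mul_zero] at this
    exact this.mono_left hle
  refine ⟨s, fun x => (hs x).1, ?_, fun x y h => ?_⟩
  · refine tendsto_nhds_unique (hst _) (tendsto_const_nhds.congr fun n => ?_)
    exact (div_self (hpos n).ne').symm
  · refine le_antisymm ?_ ?_
    · refine le_of_tendsto_of_tendsto' (hst (x + y)) ((hst x).add (hst y)) fun n => ?_
      rw [hr]
      simp only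
      rw [← add_div]
      refine div_le_div_of_nonneg_right ?_ (hpos n).le
      exact_mod_cast hA.count_add_le (he n) x y
    · have := (hst (x + y)).add herr
      rw [add_zero] at this
      refine le_of_tendsto_of_tendsto' ((hst x).add (hst y)) this fun n => ?_
      rw [hr]
      simp only
      have h₁ : (count (e n) x : ℝ) + count (e n) y ≤ count (e n) (x + y) + 2 := by
        exact_mod_cast hA.le_count_add (he n) h
      have h₂ : (2 : ℝ) / count (e n) (0 : A)ᶜ ≤ 2 * (1 / 2) ^ n := by
        rw [one_div, inv_pow, ← div_eq_mul_inv]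
        refine div_le_div_of_nonneg_left (by norm_num) (by positivity) ?_
        exact_mod_cast hcount n
      calc _ = ((count (e n) x : ℝ) + count (e n) y) / count (e n) (0 : A)ᶜ := by ring
        _ ≤ (count (e n) (x + y) + 2) / count (e n) (0 : A)ᶜ :=
          div_le_div_of_nonneg_right h₁ (hpos n).le
        _ = (count (e n) (x + y) : ℝ) / count (e n) (0 : A)ᶜ + 2 / count (e n) (0 : A)ᶜ :=
          add_div _ _ _
        _ ≤ _ := by linarith

theorem exists_state (hA : IsSimple A) : ∃ s : A → ℝ, IsState s := by
  by_cases h : ∃ e : A, e ≠ 0 ∧ ∀ x : A, x ≠ 0 → le e x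
  · obtain ⟨e, he, hmin⟩ := h
    exact ⟨_, hA.isState_of_atom he hmin⟩
  · push Not at h
    exact hA.exists_state_of_no_atom h

end IsSimple

theorem IsIdeal.nsmul_mem {I : Set A} (hI : IsIdeal I) {x : A} (hx : x ∈ I) (n : ℕ) :
    n • x ∈ I := by
  induction n with
  | zero => rw [zero_nsmul]; exact hI.zero_mem
  | succ n ih => rw [succ_nsmul]; exact hI.add_mem ih hx

/-- Characters: homomorphisms to the standard MV-algebra `[0, 1]`, as real-valued functions. -/
structure IsCharacter (φ : A → ℝ) : Prop where
  map_zero : φ 0 = 0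
  map_add : ∀ x y, φ (x + y) = min (φ x + φ y) 1
  map_compl : ∀ x, φ xᶜ = 1 - φ x

theorem IsState.isCharacter (hA : IsSimple A) {s : A → ℝ} (hs : IsState s) : IsCharacter s := by
  have hc : ∀ x, s xᶜ = 1 - s x := fun x => by
    have := hs.map_add x xᶜ (odot_compl_self x)
    rw [add_comm x, compl_add_self, hs.map_one] at this
    linarith
  refine ⟨?_, fun x y => ?_, hc⟩
  · have := hc 0
    rw [hs.map_one] at this
    linarith
  · have hle : ∀ z, s z ≤ 1 := fun z => by linarith [hc z, hs.nonneg zᶜ]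
    -- By linearity, either the partial sum is defined or `y* ≤ x`. In the latter case `x ⊕ y = 1`
    -- and the cap is attained.
    rcases hA.le_total x yᶜ with h | h
    · have := hs.map_add x y (odot_eq_zero_iff.2 h)
      rw [this, min_eq_left]
      rw [← this]
      exact hle _
    · have h₁ := hs.map_add _ _ (show odot yᶜ (odot x yᶜᶜ) = 0 by
        rw [cc, odot_comm x, ← odot_assoc, odot_comm yᶜ, odot_compl_self, zero_odot])
      rw [← eq_add_of_le h, hc y] at h₁
      have h₂ : x + y = (0 : A)ᶜ := by
        rw [le_iff, cc, add_comm] at h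
        exact h
      rw [h₂, hs.map_one, min_eq_right]
      linarith [hs.nonneg (odot x yᶜᶜ)]

namespace IsCharacter

variable {φ : A → ℝ} (hφ : IsCharacter φ)
include hφ

theorem le_one (x : A) : φ x ≤ 1 := by
  have := hφ.map_add x 0
  rw [add_zero] at this
  rw [this]
  exact min_le_right _ _

theorem nonneg (x : A) : 0 ≤ φ x := by
  linarith [hφ.le_one xᶜ, hφ.map_compl x]

theorem map_one : φ (0 : A)ᶜ = 1 := by
  rw [hφ.map_compl, hφ.map_zero, sub_zero]

theorem map_odot (x y : A) : φ (odot x y) = max (φ x + φ y - 1) 0 := by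
  unfold odot
  rw [hφ.map_compl, hφ.map_add, hφ.map_compl, hφ.map_compl]
  grind

theorem map_vee (x y : A) : φ (vee x y) = max (φ x) (φ y) := by
  have := hφ.le_one x
  have := hφ.le_one y
  unfold vee
  rw [hφ.map_add, hφ.map_odot, hφ.map_compl]
  grind

theorem map_wedge (x y : A) : φ (wedge x y) = min (φ x) (φ y) := by
  have := hφ.nonneg x
  have := hφ.nonneg y
  have := hφ.le_one y
  unfold wedge
  rw [hφ.map_odot, hφ.map_add, hφ.map_compl]
  grind

theorem map_nsmul (n : ℕ) (x : A) : φ (n • x) = min (n * φ x) 1 := by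
  have := hφ.nonneg x
  induction n with
  | zero => simp [hφ.map_zero]
  | succ n ih =>
    rw [succ_nsmul, hφ.map_add, ih]
    push_cast
    grind

theorem sum_le_one {x y : A} (h : odot x y = 0) : φ x + φ y ≤ 1 := by
  have := hφ.map_odot x y
  rw [h, hφ.map_zero] at this
  linarith [le_max_left (φ x + φ y - 1) 0]

theorem map_add_of_odot {x y : A} (h : odot x y = 0) : φ (x + y) = φ x + φ y := by
  rw [hφ.map_add, min_eq_left (hφ.sum_le_one h)]

theorem isIdeal_ker : IsIdeal {x | φ x = 0} where
  zero_mem := hφ.map_zero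
  add_mem {x y} hx hy := by
    change φ (x + y) = 0
    rw [hφ.map_add, show φ x = 0 from hx, show φ y = 0 from hy]
    norm_num
  mem_of_le {x y} h hy := by
    have h₁ := hφ.sum_le_one h
    have h₂ := hφ.nonneg x
    rw [hφ.map_compl, show φ y = 0 from hy] at h₁
    change φ x = 0
    linarith

theorem isMaximalIdeal_ker : IsMaximalIdeal {x | φ x = 0} where
  isIdeal := hφ.isIdeal_ker
  ne_univ h := by
    have : (0 : A)ᶜ ∈ {x | φ x = 0} := h ▸ Set.mem_univ _
    exact one_ne_zero (hφ.map_one.symm.trans this)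
  eq_of_subset J hJ hsub hne := by
    refine Set.Subset.antisymm (fun x hx => ?_) hsub
    by_contra hx0
    refine hne (Set.eq_univ_of_forall fun z => ?_)
    have hpos : 0 < φ x := lt_of_le_of_ne (hφ.nonneg x) (Ne.symm hx0)
    -- For this `n` the capped value `φ (n • x)` is `1`, so `(n • x)*` lies in the kernel and `J`
    -- contains `1`.
    obtain ⟨n, hn⟩ := exists_nat_ge (1 / φ x)
    have hnx : n • x ∈ J := hJ.nsmul_mem hx n
    have hc : (n • x)ᶜ ∈ J := by
      refine hsub ?_
      change φ (n • x)ᶜ = 0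
      rw [hφ.map_compl, hφ.map_nsmul, min_eq_right, sub_self]
      exact (div_le_iff₀ hpos).1 hn
    have h1 := hJ.add_mem hc hnx
    rw [compl_add_self] at h1
    exact hJ.mem_of_le (MV.le_one z) h1

theorem comp {B : Type v} [MVAlgebra B] (f : MVHom B A) : IsCharacter fun x => φ (f x) where
  map_zero := (congrArg φ f.map_zero').trans hφ.map_zero
  map_add x y := (congrArg φ (f.map_add' x y)).trans (hφ.map_add _ _)
  map_compl x := (congrArg φ (f.map_compl' x)).trans (hφ.map_compl _)

end IsCharacter

/-! ### Quotients, maximal ideals and the radical. -/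

section Quotient

variable {I : Set A} {hI : IsIdeal I}

/-- The projection `A → A / I` as a homomorphism. -/
def Quot.mkHom (hI : IsIdeal I) : MVHom A (Quot I hI) where
  toFun := Quot.mk hI
  map_zero' := rfl
  map_add' _ _ := rfl
  map_compl' _ := rfl

theorem Quot.mk_eq_zero {x : A} : Quot.mk hI x = 0 ↔ x ∈ I := by
  have hr : (idealSetoid I hI).r x 0 ↔ x ∈ I := by
    change odot x (0 : A)ᶜ ∈ I ∧ odot 0 xᶜ ∈ I ↔ x ∈ I
    rw [odot_one, zero_odot]
    exact and_iff_left hI.zero_mem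
  exact Quotient.eq.trans hr

/-- Homomorphisms out of a quotient. -/
def Quot.lift {B : Type v} [MVAlgebra B] (hI : IsIdeal I) (f : MVHom A B)
    (hf : ∀ x ∈ I, f x = 0) : MVHom (Quot I hI) B where
  toFun := Quotient.lift (s := idealSetoid I hI) f (by
    have key : ∀ x y : A, odot x yᶜ ∈ I → le (f x) (f y) := fun x y h => by
      have h0 := hf _ h
      change f.toFun ((xᶜ + yᶜᶜ)ᶜ) = 0 at h0
      rw [f.map_compl', f.map_add', f.map_compl', f.map_compl', f.map_compl'] at h0
      exact h0
    exact fun x y h => (key x y h.1).antisymm (key y x h.2))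
  map_zero' := f.map_zero'
  map_add' := by
    rintro ⟨x⟩ ⟨y⟩
    exact f.map_add' x y
  map_compl' := by
    rintro ⟨x⟩
    exact f.map_compl' x

end Quotient

theorem IsMaximalIdeal.isSimple_quot {M : Set A} (hM : IsMaximalIdeal M) :
    IsSimple (Quot M hM.isIdeal) where
  zero_ne_one h := by
    refine hM.ne_univ (Set.eq_univ_of_forall fun x => ?_)
    exact hM.isIdeal.mem_of_le (MV.le_one x) (Quot.mk_eq_zero.1 h.symm)
  exists_nsmul := by
    rintro ⟨x⟩ hx
    have hxM : x ∉ M := fun h => hx (Quot.mk_eq_zero.2 h)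
    -- The ideal generated by `M` and `x`; it is improper by maximality, so `1` lies below some `n •
    -- x + m`.
    let J : Set A := {y | ∃ n : ℕ, ∃ m ∈ M, le y (n • x + m)}
    have hJ : IsIdeal J :=
      { zero_mem := ⟨0, 0, hM.isIdeal.zero_mem, zero_le' _⟩
        add_mem := by
          rintro y z ⟨n, m, hm, h⟩ ⟨n', m', hm', h'⟩
          refine ⟨n + n', m + m', hM.isIdeal.add_mem hm hm', ?_⟩
          rw [add_nsmul, add_add_add_comm]
          exact h.add h'
        mem_of_le := by
          rintro y z h ⟨n, m, hm, h'⟩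
          exact ⟨n, m, hm, h.trans h'⟩ }
    have hJu : J = Set.univ := by
      by_contra hne
      have := hM.eq_of_subset J hJ (fun m hm => ⟨0, m, hm, by
        rw [zero_nsmul, zero_add]; exact le.refl m⟩) hne
      refine hxM (this ▸ ⟨1, 0, hM.isIdeal.zero_mem, ?_⟩)
      rw [one_nsmul, add_zero]
      exact le.refl x
    obtain ⟨n, m, hm, h⟩ : (0 : A)ᶜ ∈ J := hJu ▸ Set.mem_univ _
    refine ⟨n, ?_⟩
    have h₁ := congrArg (Quot.mk hM.isIdeal) (one_le h)
    have h₂ : ∀ k : ℕ, Quot.mk hM.isIdeal (k • x) = k • Quot.mk hM.isIdeal x := fun k => by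
      induction k with
      | zero => rw [zero_nsmul, zero_nsmul]; rfl
      | succ k ih => rw [succ_nsmul, succ_nsmul, ← ih]; rfl
    change Quot.mk hM.isIdeal (n • x) + Quot.mk hM.isIdeal m = _ at h₁
    rw [Quot.mk_eq_zero.2 hm, add_zero, h₂] at h₁
    exact h₁

/-- Every maximal ideal is the kernel of a character. -/
theorem IsMaximalIdeal.exists_character {M : Set A} (hM : IsMaximalIdeal M) :
    ∃ φ : A → ℝ, IsCharacter φ ∧ {x | φ x = 0} = M := by
  obtain ⟨s, hs⟩ := hM.isSimple_quot.exists_state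
  have hφ := (hs.isCharacter hM.isSimple_quot).comp (Quot.mkHom hM.isIdeal)
  refine ⟨_, hφ, hM.eq_of_subset _ hφ.isIdeal_ker (fun x hx => ?_) hφ.isMaximalIdeal_ker.ne_univ⟩
  change s (Quot.mk hM.isIdeal x) = 0
  rw [Quot.mk_eq_zero.2 hx, (hs.isCharacter hM.isSimple_quot).map_zero]

theorem mem_rad_iff {x : A} : x ∈ rad A ↔ ∀ φ : A → ℝ, IsCharacter φ → φ x = 0 := by
  refine ⟨fun h φ hφ => h _ hφ.isMaximalIdeal_ker, fun h M hM => ?_⟩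
  obtain ⟨φ, hφ, rfl⟩ := hM.exists_character
  exact h φ hφ

theorem IsSemisimple.eq_zero (hA : IsSemisimple A) {x : A}
    (h : ∀ φ : A → ℝ, IsCharacter φ → φ x = 0) : x = 0 := by
  have : x ∈ rad A := mem_rad_iff.2 h
  rw [show rad A = {0} from hA] at this
  exact this

theorem IsSemisimple.ext (hA : IsSemisimple A) {x y : A}
    (h : ∀ φ : A → ℝ, IsCharacter φ → φ x = φ y) : x = y := by
  have key : ∀ x y : A, (∀ φ : A → ℝ, IsCharacter φ → φ x = φ y) → le x y := fun x y h =>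
    hA.eq_zero fun φ hφ => by
      rw [hφ.map_odot, hφ.map_compl, h φ hφ, max_eq_right]
      linarith
  exact (key x y h).antisymm (key y x fun φ hφ => (h φ hφ).symm)

theorem map_mem_rad {B : Type v} [MVAlgebra B] (f : MVHom A B) {x : A} (hx : x ∈ rad A) :
    f x ∈ rad B :=
  mem_rad_iff.2 fun _ hφ => mem_rad_iff.1 hx _ (hφ.comp f)

theorem isSemisimple_quot_rad (A : Type u) [MVAlgebra A] :
    IsSemisimple (Quot (rad A) rad_isIdeal) := by
  refine Set.Subset.antisymm ?_ (Set.singleton_subset_iff.2 rad_isIdeal.zero_mem)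
  rintro ⟨x⟩ hx
  refine Quot.mk_eq_zero.2 (mem_rad_iff.2 fun φ hφ => ?_)
  -- Every character of `A` vanishes on the radical, hence descends to the quotient.
  have hker : ∀ a b : A, (idealSetoid (rad A) rad_isIdeal).r a b → φ a = φ b := fun a b h => by
    have h₁ := hφ.map_odot a bᶜ
    have h₂ := hφ.map_odot b aᶜ
    rw [mem_rad_iff.1 h.1 φ hφ, hφ.map_compl] at h₁
    rw [mem_rad_iff.1 h.2 φ hφ, hφ.map_compl] at h₂
    grind
  have hψ : IsCharacter (A := Quot (rad A) rad_isIdeal) (Quotient.lift φ hker) :=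
    { map_zero := hφ.map_zero
      map_add := by
        rintro ⟨a⟩ ⟨b⟩
        exact hφ.map_add a b
      map_compl := by
        rintro ⟨a⟩
        exact hφ.map_compl a }
  exact mem_rad_iff.1 hx _ hψ

end MV

/-! ### Additive functions on the rational unit interval. -/

namespace MV

theorem RatUnit.isCharacter : IsCharacter fun q : RatUnit => ((q.1 : ℚ) : ℝ) where
  map_zero := Rat.cast_zero
  map_add x y := by
    change ((min (x.1 + y.1) 1 : ℚ) : ℝ) = _
    push_cast
    rfl
  map_compl x := by
    change ((1 - x.1 : ℚ) : ℝ) = _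
    push_cast
    rfl

theorem RatUnit.odot_eq_zero {x y : RatUnit} (h : x.1 + y.1 ≤ 1) : odot x y = 0 := by
  apply Subtype.ext
  change 1 - min (1 - x.1 + (1 - y.1)) 1 = 0
  rw [min_eq_right (by linarith), sub_self]

theorem RatUnit.add_val {x y : RatUnit} (h : x.1 + y.1 ≤ 1) : (x + y).1 = x.1 + y.1 :=
  min_eq_left h

/-- A function on `[0, 1]_ℚ` that is additive on partial sums is linear. -/
theorem RatUnit.eq_mul_of_additive {γ : RatUnit → ℝ}
    (hγ : ∀ x y : RatUnit, odot x y = 0 → γ (x + y) = γ x + γ y) (q : RatUnit) :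
    γ q = q.1 * γ (one RatUnit) := by
  have h0 : γ 0 = 0 := by
    have := hγ 0 0 (odot_zero 0)
    rw [add_zero] at this
    linarith
  have key : ∀ (n : ℕ) (hn : 0 < n) (k : ℕ) (p : RatUnit), p.1 = (k : ℚ) / n →
      γ p = k * γ ⟨1 / n, by positivity,
        (div_le_one (by positivity)).2 (by exact_mod_cast hn)⟩ := by
    intro n hn k
    have hn' : (0 : ℚ) < n := by exact_mod_cast hn
    induction k with
    | zero =>
      intro p hp
      have : p = 0 := Subtype.ext (by rw [hp, Nat.cast_zero, zero_div]; rfl)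
      rw [this, h0, Nat.cast_zero, zero_mul]
    | succ k ih =>
      intro p hp
      have hk : ((k : ℚ)) / n ≤ 1 := by
        refine _root_.le_trans ?_ (hp ▸ p.2.2)
        gcongr
        simp
      have hsum : (k : ℚ) / n + 1 / n = p.1 := by
        rw [hp]
        push_cast
        ring
      let x : RatUnit := ⟨k / n, by positivity, hk⟩
      let y : RatUnit := ⟨1 / n, by positivity,
        (div_le_one (by positivity)).2 (by exact_mod_cast hn)⟩
      have hle : x.1 + y.1 ≤ 1 := hsum.trans_le p.2.2
      have hp' : p = x + y := Subtype.ext (by rw [RatUnit.add_val hle]; exact hsum.symm)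
      rw [hp', hγ x y (RatUnit.odot_eq_zero hle), ih x rfl]
      push_cast
      ring
  have hn := q.1.den_pos
  have hq : q.1 = (q.1.num.toNat : ℚ) / q.1.den := by
    conv_lhs => rw [← Rat.num_div_den q.1]
    congr 1
    have := Int.toNat_of_nonneg (Rat.num_nonneg.2 q.2.1)
    exact_mod_cast this.symm
  -- Both `q` and `1 = den / den` are multiples of the same unit fraction `1 / den`.
  have h₁ := key q.1.den hn q.1.num.toNat q hq
  have h₂ := key q.1.den hn q.1.den (one RatUnit) (by
    rw [div_self (by exact_mod_cast hn.ne')]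
    exact sub_zero 1)
  have hq' : (q.1 : ℝ) = (q.1.num.toNat : ℝ) / q.1.den := by
    refine (congrArg Rat.cast hq).trans ?_
    push_cast
    rfl
  have : (q.1.den : ℝ) ≠ 0 := by exact_mod_cast hn.ne'
  rw [h₁, h₂, hq', ← mul_assoc, div_mul_cancel₀ _ this]

/-! ### Division operators seen through characters. -/

section DMV

variable {D : Type u} [MVAlgebra D] [DMVAlgebra D]

theorem IsCharacter.map_δ {φ : D → ℝ} (hφ : IsCharacter φ) (n : ℕ+) (x : D) :
    φ (DMVAlgebra.δ n x) = φ x / n := by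
  have h₁ := congrArg φ (DMVAlgebra.nsmul_δ n x)
  have h₂ := hφ.sum_le_one (DMVAlgebra.δ_odot n x)
  rw [hφ.map_nsmul] at h₁ h₂
  have hn : (1 : ℝ) ≤ ((n : ℕ) : ℝ) := by exact_mod_cast n.pos
  rw [Nat.cast_sub n.pos, Nat.cast_one] at h₂
  set d := φ (DMVAlgebra.δ n x)
  have hd := hφ.nonneg (DMVAlgebra.δ n x)
  have hd' := hφ.le_one (DMVAlgebra.δ n x)
  -- The axiom `δ_odot` reads `d + min ((n - 1) * d) 1 ≤ 1`. If the cap were active, `d` would be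
  -- `0`.
  have hnd : (n : ℕ) * d ≤ 1 := by
    rcases le_total ((((n : ℕ) : ℝ) - 1) * d) 1 with h | h
    · rw [min_eq_left h] at h₂
      linarith
    · rw [min_eq_right h] at h₂
      have : d = 0 := by linarith [show 0 ≤ d from hd]
      rw [this, mul_zero]
      exact zero_le_one
  rw [min_eq_left hnd] at h₁
  rw [eq_div_iff (by positivity), ← h₁, mul_comm]

/-- Homomorphisms into a semisimple DMV-algebra commute with the division operators. -/
theorem map_δ_of_isSemisimple {E : Type v} [MVAlgebra E] [DMVAlgebra E] (hE : IsSemisimple E)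
    (f : MVHom D E) (n : ℕ+) (x : D) : f (DMVAlgebra.δ n x) = DMVAlgebra.δ n (f x) :=
  hE.ext fun φ hφ => by rw [hφ.map_δ, (hφ.comp f).map_δ]

/-- The action of `[0, 1]_ℚ` on a DMV-algebra. -/
def ratSMul (q : RatUnit) (d : D) : D :=
  q.1.num.toNat • DMVAlgebra.δ ⟨q.1.den, q.1.den_pos⟩ d

theorem IsCharacter.map_ratSMul {φ : D → ℝ} (hφ : IsCharacter φ) (q : RatUnit) (d : D) :
    φ (ratSMul q d) = q.1 * φ d := by
  unfold ratSMul
  have h : ((q.1.num.toNat : ℕ) : ℝ) = (q.1.num : ℝ) := by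
    exact_mod_cast Int.toNat_of_nonneg (Rat.num_nonneg.2 q.2.1)
  have h' : (q.1 : ℝ) = q.1.num / q.1.den := by
    exact_mod_cast (Rat.num_div_den q.1).symm
  have hδ : φ (DMVAlgebra.δ ⟨q.1.den, q.1.den_pos⟩ d) = φ d / q.1.den := hφ.map_δ _ _
  have hq : (q.1.num : ℝ) * (φ d / q.1.den) = q.1 * φ d := by rw [h']; ring
  rw [hφ.map_nsmul, hδ, h, hq]
  exact min_eq_left
    (mul_le_one₀ (RatUnit.isCharacter.le_one q) (hφ.nonneg d) (hφ.le_one d))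

/-- Under each character the map becomes multiplication of reals in `[0, 1]`, which is monotone and
additive in each factor. -/
theorem ratSMul_isBimorphism {B : Type v} [MVAlgebra B] (hD : IsSemisimple D) (f : MVHom B D) :
    IsBimorphism fun (q : RatUnit) (b : B) => ratSMul q (f b) := by
  have hχ := RatUnit.isCharacter
  have hsum : ∀ {s t : D}, (∀ φ : D → ℝ, IsCharacter φ → φ s + φ t ≤ 1) → odot s t = 0 :=
    fun h => hD.eq_zero fun φ hφ => by
      rw [hφ.map_odot, max_eq_right]
      linarith [h φ hφ]
  refine ⟨?_, ?_, ?_, ?_, ?_, ?_, ?_, ?_, ?_⟩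
  · refine hD.ext fun φ hφ => ?_
    rw [hφ.map_ratSMul, one, one, one, hφ.map_one, (hφ.comp f).map_one, hχ.map_one, one_mul]
  · refine fun x₁ x₂ y => hD.ext fun φ hφ => ?_
    rw [hφ.map_vee, hφ.map_ratSMul, hφ.map_ratSMul, hφ.map_ratSMul, hχ.map_vee,
      max_mul_of_nonneg _ _ (hφ.nonneg _)]
  · refine fun x y₁ y₂ => hD.ext fun φ hφ => ?_
    rw [hφ.map_vee, hφ.map_ratSMul, hφ.map_ratSMul, hφ.map_ratSMul, (hφ.comp f).map_vee,
      mul_max_of_nonneg _ _ (hχ.nonneg x)]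
  · refine fun x₁ x₂ y => hD.ext fun φ hφ => ?_
    rw [hφ.map_wedge, hφ.map_ratSMul, hφ.map_ratSMul, hφ.map_ratSMul, hχ.map_wedge,
      min_mul_of_nonneg _ _ (hφ.nonneg _)]
  · refine fun x y₁ y₂ => hD.ext fun φ hφ => ?_
    rw [hφ.map_wedge, hφ.map_ratSMul, hφ.map_ratSMul, hφ.map_ratSMul, (hφ.comp f).map_wedge,
      mul_min_of_nonneg _ _ (hχ.nonneg x)]
  · refine fun x₁ x₂ y h => hsum fun φ hφ => ?_
    rw [hφ.map_ratSMul, hφ.map_ratSMul, ← add_mul]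
    exact mul_le_one₀ (hχ.sum_le_one h) (hφ.nonneg _) (hφ.le_one _)
  · refine fun x y₁ y₂ h => hsum fun φ hφ => ?_
    have h' := (hφ.comp f).sum_le_one h
    rw [hφ.map_ratSMul, hφ.map_ratSMul, ← mul_add]
    exact mul_le_one₀ (hχ.le_one x) (add_nonneg (hφ.nonneg _) (hφ.nonneg _)) h'
  · refine fun x₁ x₂ y h => hD.ext fun φ hφ => ?_
    have h' := hχ.sum_le_one h
    rw [hφ.map_add, hφ.map_ratSMul, hφ.map_ratSMul, hφ.map_ratSMul, hχ.map_add_of_odot h,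
      add_mul, min_eq_left]
    rw [← add_mul]
    exact mul_le_one₀ h' (hφ.nonneg _) (hφ.le_one _)
  · refine fun x y₁ y₂ h => hD.ext fun φ hφ => ?_
    have h' := (hφ.comp f).sum_le_one h
    rw [hφ.map_add, hφ.map_ratSMul, hφ.map_ratSMul, hφ.map_ratSMul,
      (hφ.comp f).map_add_of_odot h, mul_add, min_eq_left]
    rw [← mul_add]
    exact mul_le_one₀ (hχ.le_one x) (add_nonneg (hφ.nonneg _) (hφ.nonneg _)) h'

end DMV

/-! ### Characters, division and extensions on the rational tensor product. -/

section RatTensor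

variable {B : Type u} [MVAlgebra B]

/-- Additivity of characters of the tensor product in the first variable. -/
theorem IsCharacter.map_stmul {φ : RatTensor B → ℝ} (hφ : IsCharacter φ) (q : RatUnit) (b : B) :
    φ (stmul q b) = q.1 * φ (RatTensor.ι B b) := by
  have hψ := hφ.comp (Quot.mkHom (rad_isIdeal (A := Tensor RatUnit B)))
  refine RatUnit.eq_mul_of_additive (γ := fun q => φ (stmul q b)) (fun x y h => ?_) q
  have hb := Tensor.tmul_isBimorphism (A := RatUnit) (B := B)
  change φ (Quot.mkHom _ (Tensor.tmul (x + y) b)) = _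
  rw [hb.map_add_left x y b h]
  exact hψ.map_add_of_odot (hb.sumDefined_left x y b h)

theorem IsCharacter.map_ι_add {φ : RatTensor B → ℝ} (hφ : IsCharacter φ) {x y : B}
    (h : odot x y = 0) :
    φ (RatTensor.ι B (x + y)) = φ (RatTensor.ι B x) + φ (RatTensor.ι B y) := by
  have hψ := hφ.comp (Quot.mkHom (rad_isIdeal (A := Tensor RatUnit B)))
  have hb := Tensor.tmul_isBimorphism (A := RatUnit) (B := B)
  change φ (Quot.mkHom _ (Tensor.tmul _ (x + y))) = _
  rw [hb.map_add_right _ x y h]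
  exact hψ.map_add_of_odot (hb.sumDefined_right _ x y h)

theorem IsCharacter.comp_ι {φ : RatTensor B → ℝ} (hφ : IsCharacter φ) :
    IsCharacter fun b => φ (RatTensor.ι B b) := by
  have hψ := hφ.comp (Quot.mkHom (rad_isIdeal (A := Tensor RatUnit B)))
  have hb := Tensor.tmul_isBimorphism (A := RatUnit) (B := B)
  have h1 : φ (RatTensor.ι B (0 : B)ᶜ) = 1 := by
    change φ (Quot.mkHom _ (Tensor.tmul (one RatUnit) (one B))) = 1
    rw [hb.map_one_one]
    exact hψ.map_one
  have h0 : φ (RatTensor.ι B 0) = 0 := by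
    have := hφ.map_ι_add (odot_zero (0 : B))
    rw [add_zero] at this
    linarith
  have hc : ∀ x : B, φ (RatTensor.ι B xᶜ) = 1 - φ (RatTensor.ι B x) := fun x => by
    have := hφ.map_ι_add (odot_compl_self x)
    rw [add_comm x, compl_add_self, h1] at this
    linarith
  refine ⟨h0, fun x y => ?_, hc⟩
  -- A bimorphism respects only partial sums, so `x ⊕ y` is rewritten as the defined sum of `x` and
  -- `y ∧ x*`.
  have hw : φ (RatTensor.ι B (wedge y xᶜ)) = min (φ (RatTensor.ι B y)) (φ (RatTensor.ι B xᶜ)) := by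
    change φ (Quot.mkHom _ (Tensor.tmul _ (wedge y xᶜ))) = _
    rw [hb.map_wedge_right]
    exact hψ.map_wedge _ _
  have hd : odot x (wedge y xᶜ) = 0 := by
    rw [odot_comm, odot_eq_zero_iff]
    exact odot_le_right _ _
  have hs : x + wedge y xᶜ = x + y := by
    have h := eq_add_of_le (le_add_right x y)
    rw [h]
    unfold wedge
    rw [cc, add_comm y x]
  rw [← hs, hφ.map_ι_add hd, hw, hc]
  grind

/-- The map `ι_B` as a homomorphism. -/
def ιHom (B : Type u) [MVAlgebra B] : MVHom B (RatTensor B) where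
  toFun := RatTensor.ι B
  map_zero' := (isSemisimple_quot_rad _).ext fun _ hφ =>
    hφ.comp_ι.map_zero.trans hφ.map_zero.symm
  map_add' x y := (isSemisimple_quot_rad _).ext fun _ hφ =>
    (hφ.comp_ι.map_add x y).trans (hφ.map_add _ _).symm
  map_compl' x := (isSemisimple_quot_rad _).ext fun _ hφ =>
    (hφ.comp_ι.map_compl x).trans (hφ.map_compl _).symm

theorem RatTensor.induction {p : RatTensor B → Prop} (hstmul : ∀ q b, p (stmul q b))
    (hzero : p 0) (hadd : ∀ x y, p x → p y → p (x + y)) (hcompl : ∀ x, p x → p xᶜ)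
    (x : RatTensor B) : p x := by
  obtain ⟨y⟩ := x
  obtain ⟨t⟩ := y
  change p (Quot.mk _ (Tensor.mk t))
  induction t with
  | tmul a b => exact hstmul a b
  | zero => exact hzero
  | add s t ihs iht => exact hadd _ _ ihs iht
  | compl s ih => exact hcompl _ ih

theorem RatTensor.exists_div (n : ℕ+) (x : RatTensor B) :
    ∃ y : RatTensor B, ∀ φ : RatTensor B → ℝ, IsCharacter φ → φ y = φ x / n := by
  have hn : (1 : ℝ) ≤ ((n : ℕ) : ℝ) := by exact_mod_cast n.pos
  have hnQ : (1 : ℚ) ≤ ((n : ℕ) : ℚ) := by exact_mod_cast n.pos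
  have hstmul : ∀ (q : RatUnit) (b : B), ∃ y : RatTensor B,
      ∀ φ : RatTensor B → ℝ, IsCharacter φ → φ y = φ (stmul q b) / n := fun q b => by
    refine ⟨stmul ⟨q.1 / n, div_nonneg q.2.1 (by positivity),
      (div_le_self q.2.1 hnQ).trans q.2.2⟩ b, fun φ hφ => ?_⟩
    refine (hφ.map_stmul _ b).trans ?_
    rw [hφ.map_stmul]
    push_cast
    ring
  -- The element `c = (1/n) ⊗ 1` has value `1/n` under every character and acts as the scaled unit.
  obtain ⟨c, hc⟩ := hstmul (one RatUnit) (one B)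
  replace hc : ∀ φ : RatTensor B → ℝ, IsCharacter φ → φ c = 1 / n := fun φ hφ => by
    rw [hc φ hφ, ← hφ.comp_ι.map_one]
    rfl
  have hn0 : (0 : ℝ) < ((n : ℕ) : ℝ) := by linarith
  induction x using RatTensor.induction with
  | hstmul q b => exact hstmul q b
  | hzero => exact ⟨0, fun φ hφ => by rw [hφ.map_zero, zero_div]⟩
  | hadd x y hx hy =>
    obtain ⟨x', hx⟩ := hx
    obtain ⟨y', hy⟩ := hy
    -- Dividing `min (x + y) 1` by `n` moves the cap from `1` to `1/n`, hence the meet with `c`.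
    refine ⟨wedge (x' + y') c, fun φ hφ => ?_⟩
    have h1 : (1 : ℝ) / n ≤ 1 := (div_le_one hn0).2 hn
    rw [hφ.map_wedge, hφ.map_add, hφ.map_add, hx φ hφ, hy φ hφ, hc φ hφ, min_assoc,
      min_eq_right h1, ← add_div, min_div_div_right hn0.le]
  | hcompl x hx =>
    obtain ⟨x', hx⟩ := hx
    refine ⟨odot c x'ᶜ, fun φ hφ => ?_⟩
    have h1 : φ x / n ≤ 1 / n := div_le_div_of_nonneg_right (hφ.le_one x) hn0.le
    rw [hφ.map_odot, hφ.map_compl, hφ.map_compl, hx φ hφ, hc φ hφ, max_eq_left (by linarith),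
      sub_div]
    ring

/-- The division operators on `[0, 1]_ℚ ⊗ B`. -/
noncomputable abbrev RatTensor.dmv (B : Type u) [MVAlgebra B] : DMVAlgebra (RatTensor B) where
  δ n x := (RatTensor.exists_div n x).choose
  nsmul_δ n x := (isSemisimple_quot_rad _).ext fun φ hφ => by
    have hn : (n : ℝ) ≠ 0 := by exact_mod_cast n.ne_zero
    rw [hφ.map_nsmul, (RatTensor.exists_div n x).choose_spec φ hφ, mul_div_cancel₀ _ hn,
      min_eq_left (hφ.le_one x)]
  δ_odot n x := (isSemisimple_quot_rad _).eq_zero fun φ hφ => by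
    have hn : (1 : ℝ) ≤ ((n : ℕ) : ℝ) := by exact_mod_cast n.pos
    have hn0 : ((n : ℕ) : ℝ) ≠ 0 := by linarith
    rw [hφ.map_odot, hφ.map_nsmul, (RatTensor.exists_div n x).choose_spec φ hφ,
      Nat.cast_sub n.pos, Nat.cast_one, max_eq_right]
    refine (sub_le_sub_right (add_le_add_right (min_le_left _ _) _) 1).trans ?_
    have : φ x / n + ((n : ℕ) - 1) * (φ x / n) - 1 = φ x - 1 := by
      field_simp
      ring
    rw [this]
    linarith [hφ.le_one x]

/-- Homomorphisms from `[0, 1]_ℚ ⊗ B` to a semisimple MV-algebra are determined by their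
values on the elements `1 ⊗ b`. -/
theorem RatTensor.hom_ext {D : Type v} [MVAlgebra D] (hD : IsSemisimple D)
    {g h : MVHom (RatTensor B) D} (hgh : ∀ b, g (RatTensor.ι B b) = h (RatTensor.ι B b)) :
    g = h := by
  apply MVHom.ext
  funext x
  induction x using RatTensor.induction with
  | hstmul q b =>
    refine hD.ext fun φ hφ => ((hφ.comp g).map_stmul q b).trans ?_
    rw [hgh]
    exact ((hφ.comp h).map_stmul q b).symm
  | hzero => rw [g.map_zero', h.map_zero']
  | hadd x y hx hy => rw [g.map_add', h.map_add', hx, hy]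
  | hcompl x hx => rw [g.map_compl', h.map_compl', hx]

/-- The extension of a homomorphism `B → D` into a semisimple DMV-algebra. -/
theorem RatTensor.exists_lift {D : Type v} [MVAlgebra D] [DMVAlgebra D] (hD : IsSemisimple D)
    (f : MVHom B D) : ∃ g : MVHom (RatTensor B) D, ∀ b, g (RatTensor.ι B b) = f b := by
  obtain ⟨ω, hω, -⟩ := Tensor.existsUnique_lift (ratSMul_isBimorphism hD f)
  -- Homomorphisms map radical to radical, and that of `D` is `{0}`, so `ω` factors through the
  -- semisimple quotient.
  refine ⟨Quot.lift rad_isIdeal ω fun x hx => ?_, fun b => (hω _ b).trans ?_⟩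
  · have := map_mem_rad ω hx
    rwa [show rad D = {0} from hD] at this
  · refine hD.ext fun φ hφ => ?_
    rw [hφ.map_ratSMul, one, RatUnit.isCharacter.map_one, one_mul]

end RatTensor

end MV

/-! ### The universal arrow and the adjunction. -/

section Adjunction

open MV

/-- Valid for any choice of division operators, since the MV-extension preserves them automatically.
-/
theorem RatTensor.existsUnique_lift (hss : ∀ B : MVss.{u}, IsSemisimple (RatTensor B))
    (δ : ∀ B : MVss.{u}, DMVAlgebra (RatTensor B)) (B : MVss.{u}) (D : DMVss.{u})
    (f : B ⟶ DMVss.forgetδ.obj D) :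
    ∃! g : RatTensor.obj hss δ B ⟶ D, ∀ b : B, g (RatTensor.ι B b) = f b := by
  let := δ B
  obtain ⟨g, hg⟩ := MV.RatTensor.exists_lift D.semisimple (f : MVHom B D)
  refine ⟨⟨g, map_δ_of_isSemisimple D.semisimple g⟩, hg, fun h hh => ?_⟩
  have hfun : DMVHom.toMVHom h = g :=
    RatTensor.hom_ext D.semisimple fun b => (hh b).trans (hg b).symm
  exact DMVHom.ext (congrArg MVHom.toFun hfun)

theorem mainTheorem10 :
    ∃ (hss : ∀ B : MVss.{u}, MV.IsSemisimple (RatTensor B))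
      (δ : ∀ B : MVss.{u}, DMVAlgebra (RatTensor B))
      (hmap : ∀ (A B : MVss.{u}) (f : A ⟶ B),
        ∃! g : RatTensor.obj hss δ A ⟶ RatTensor.obj hss δ B,
          ∀ a : A, g (RatTensor.ι A a) = RatTensor.ι B (f a))
      (adj : Dtensor hss δ hmap ⊣ DMVss.forgetδ.{u}),
      ∀ (B : MVss.{u}) (b : B), adj.unit.app B b = RatTensor.ι B b := by
  let hss : ∀ B : MVss.{u}, MV.IsSemisimple (RatTensor B) := fun B => isSemisimple_quot_rad _
  let δ : ∀ B : MVss.{u}, DMVAlgebra (RatTensor B) := fun B => RatTensor.dmv B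
  let ι : ∀ B : MVss.{u}, B ⟶ DMVss.forgetδ.obj (RatTensor.obj hss δ B) := fun B => ιHom B
  have hlift := RatTensor.existsUnique_lift hss δ
  have hmap : ∀ (A B : MVss.{u}) (f : A ⟶ B),
      ∃! g : RatTensor.obj hss δ A ⟶ RatTensor.obj hss δ B,
        ∀ a : A, g (RatTensor.ι A a) = RatTensor.ι B (f a) := fun A B f =>
    hlift A (RatTensor.obj hss δ B) (f ≫ ι B)
  let adj : Dtensor hss δ hmap ⊣ DMVss.forgetδ.{u} := Adjunction.mkOfHomEquiv
    { homEquiv := fun B D =>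
        { toFun := fun g => ι B ≫ DMVss.forgetδ.map g
          invFun := fun f => (hlift B D f).choose
          left_inv := fun g =>
            (hlift B D _).unique (hlift B D _).choose_spec.1 (fun _ => rfl)
          right_inv := fun f => MVHom.ext (funext (hlift B D f).choose_spec.1) }
      -- Both sides extend the composite of `f` and `g` along `ι_A`, so uniqueness identifies them.
      homEquiv_naturality_left_symm := fun {A B D} f g =>
        (hlift A D (f ≫ g)).unique (hlift A D (f ≫ g)).choose_spec.1 fun a =>
          (congrArg _ ((hmap A B f).choose_spec.1 a)).trans
            ((hlift B D g).choose_spec.1 (f a))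
      homEquiv_naturality_right := fun _ _ => rfl }
  exact ⟨hss, δ, hmap, adj, fun B b => rfl⟩

end Adjunction
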